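/- For a finite group $G$ and a subgroup $H \le G$, let $\mathrm{Ind}_H^G\mathbb{Z}=\mathrm{Hom}_{\mathbb{Z}[H]}(\mathbb{Z}[G],\mathbb{Z})$ (with $(g\varphi)(g')=\varphi(g'g)$), and let $J_{G/H}$ be the $G$-module defined by the exact sequence $$0\to \mathbb{Z}\xrightarrow{\ \varepsilon\ } \mathrm{Ind}_H^G\mathbb{Z}\to J_{G/H}\to 0,$$ where $\varepsilon(n)$ is the function taking the constant value $n$ on $G$. For a $G$-module $M$ put $$Ш^2_\omega(G,M)=\mathrm{Ker}\Big(H^2(G,M)\to\bigoplus_{D} H^2(D,M)\Big),$$ where $D$ runs over all cyclic subgroups of $G$ and the maps are the restriction maps. Let $p>2$ be an odd prime number, and let $G^\dagger$ be a subgroup of $\mathrm{SL}_2(\mathbb{F}_p)$. Put $$G:=(C_p)^2\rtimes_\varphi G^\dagger,\qquad H:=\{1\}\rtimes_\varphi G^\dagger,$$ where $(C_p)^2$ is identified with $\mathbb{F}_p^2$ and $\varphi$ is induced by the standard representation of $\mathrm{SL}_2(\mathbb{F}_p)$. Then there is an isomorphism $$Ш^2_\omega(G,J_{G/H})\cong\mathbb{Z}/p.$$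 In particular, this holds for $G=(C_p)^2\rtimes_\varphi \mathrm{SL}_2(\mathbb{F}_p)$ and $H=\{1\}\rtimes_\varphi\mathrm{SL}_2(\mathbb{F}_p)$. -/

import Mathlib

open CategoryTheory

open scoped MatrixGroups

noncomputable section

namespace ChevalleySha

section Cohomology

variable {G : Type} [Group G]

/-- The module `Ind_H^G ℤ = Hom_{ℤ[H]}(ℤ[G], ℤ)` for the trivial `H`-module `ℤ`: functions
`f : G → ℤ` with `f (h * g) = f g` for `h ∈ H`, on which `g` acts by `(g • f) g' = f (g' * g)`. -/
abbrev indZ (H : Subgroup G) : Rep.{0} ℤ G :=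
  Rep.coind H.subtype (Rep.trivial ℤ H ℤ)

/-- The diagonal embedding `ε : ℤ → Ind_H^G ℤ` of `G`-modules, sending `n` to the constant
function with value `n`. -/
def diag (H : Subgroup G) : Rep.trivial ℤ G ℤ ⟶ indZ H :=
  Rep.ofHom
    { toFun := fun n => ⟨fun _ => n, fun _ _ => rfl⟩
      map_add' := fun _ _ => rfl
      map_smul' := fun _ _ => rfl
      isIntertwining' := fun _ => rfl }

/-- The image of `ε` is stable under `G`. -/
theorem range_diag_le_comap (H : Subgroup G) (g : G) :
    LinearMap.range (diag H).hom.toLinearMap ≤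
      (LinearMap.range (diag H).hom.toLinearMap).comap ((indZ H).ρ g) := by
  rintro _ ⟨n, rfl⟩
  exact ⟨n, rfl⟩

/-- The Chevalley module `J_{G/H}`, the cokernel in
`0 → ℤ → Ind_H^G ℤ → J_{G/H} → 0`. -/
def chevalleyModule (H : Subgroup G) : Rep.{0} ℤ G :=
  (indZ H).quotient (LinearMap.range (diag H).hom.toLinearMap) (range_diag_le_comap H)

/-- The restriction map `Hⁿ(G, M) → Hⁿ(D, M)` to a subgroup `D` of `G`. -/
def restriction (M : Rep.{0} ℤ G) (D : Subgroup G) (n : ℕ) :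
    groupCohomology M n ⟶ groupCohomology (Rep.res D.subtype M) n :=
  groupCohomology.map D.subtype (𝟙 (Rep.res D.subtype M)) n

/-- `Ш²_𝒟(G, M)`: the classes in `H²(G, M)` whose restriction to every `D ∈ 𝒟` vanishes. -/
def sha (𝒟 : Set (Subgroup G)) (M : Rep.{0} ℤ G) : Submodule ℤ (groupCohomology M 2) :=
  ⨅ D ∈ 𝒟, LinearMap.ker (restriction M D 2).hom

/-- `Ш²_ω(G, M)`: the case in which `𝒟` is the set of all cyclic subgroups of `G`. -/
def shaOmega (M : Rep.{0} ℤ G) : Submodule ℤ (groupCohomology M 2) :=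
  sha {D : Subgroup G | IsCyclic D} M

end Cohomology

/-- The action of `SL₂(𝔽_p)` on `(C_p)²` (the additive group `𝔽_p²`, written multiplicatively)
given by the standard representation `(g, v) ↦ g v`. -/
def stdAction (p : ℕ) : SL(2, ZMod p) →* MulAut (Multiplicative (Fin 2 → ZMod p)) where
  toFun g := AddEquiv.toMultiplicative (Matrix.SpecialLinearGroup.toLin' g).toAddEquiv
  map_one' := by
    ext v : 1
    exact congrArg Multiplicative.ofAdd (Matrix.one_mulVec v.toAdd)
  map_mul' g h := by
    ext v : 1
    exact congrArg Multiplicative.ofAdd (Matrix.mulVec_mulVec v.toAdd g.1 h.1).symm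

/-- The semidirect product `(C_p)² ⋊ G'`, for a subgroup `G'` of `SL₂(𝔽_p)` acting through the
standard representation. -/
abbrev affineGroup (p : ℕ) (G' : Subgroup SL(2, ZMod p)) : Type :=
  Multiplicative (Fin 2 → ZMod p) ⋊[(stdAction p).comp G'.subtype] G'

/-- The complement `{1} ⋊ G'` in `(C_p)² ⋊ G'`. -/
abbrev pointStabilizer (p : ℕ) (G' : Subgroup SL(2, ZMod p)) : Subgroup (affineGroup p G') :=
  (SemidirectProduct.inr : G' →* affineGroup p G').range

end ChevalleySha

end

noncomputable section

namespace ChevalleySha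

/-! ### From `2`-cocycles of `J_{G/H}` to circle-valued `1`-cocycles modulo constants -/

section Bridge

variable {G : Type} [Group G]

/-! Write `V = 𝔽_p²`, `K` for the complement and `𝕋 = ℝ/ℤ`. Averaging over a finite group kills
cohomology with real coefficients, so `H²(G, J_{G/H})` is `H¹` of `G` in the functions `H \ G → 𝕋`
modulo constants, compatibly with restriction to subgroups (`exists_cochain_iff`,
`exists_circleCochain_eq`). Here `H \ G` is `V`, on which `G` acts by affine maps.

Restricted to `V`, such a cocycle is a factor set `V × V → 𝕋`, and its antisymmetrization is an
alternating pairing on `V`. The pairing is determined by its value on the standard basis, which is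
killed by `p`. This value, `pairingValue`, vanishes on coboundaries and embeds `Ш²_ω` in the
`p`-torsion of `𝕋`, a copy of `ℤ/p`, with the following two facts giving the isomorphism.

Injectivity: if the pairing vanishes, the factor set is symmetric and splits because `𝕋` is
divisible (`exists_splitting`). After subtracting a coboundary, the cocycle is zero on `V` and
becomes a `1`-cocycle of `K` in `Hom(V, 𝕋)`. Local triviality forces its value at `k` to vanish on
vectors fixed by `k`; this makes it a coboundary on a Sylow `p`-subgroup, which is trivial or
generated by a transvection, and hence on `K` (`exists_eq_dualCoboundary`).

Surjectivity: the symplectic form is `SL₂`-invariant, so it defines a cocycle `heisenberg` with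
arbitrary `p`-torsion pairing. It is locally trivial (`ActsThrough.exists_heisenberg_eq`): an affine
map with a fixed point gives an explicit primitive, and one without has unipotent linear part, where
the obstruction is a sum over `p` iterates that is independent of the starting point because `0 + 1
+ ⋯ + (p - 1)` is divisible by the odd prime `p`. -/

theorem H2π_eq_zero_iff_exists (M : Rep.{0} ℤ G) (x : groupCohomology.cocycles₂ M) :
    groupCohomology.H2π M x = 0 ↔
      ∃ m : G → M, ∀ g h : G, M.ρ g (m h) - m (g * h) + m g = x (g, h) := by
  rw [groupCohomology.H2π_eq_zero_iff]
  constructor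
  · rintro ⟨m, hm⟩
    exact ⟨m, fun g h => congrFun hm (g, h)⟩
  · rintro ⟨m, hm⟩
    exact ⟨m, funext fun gh => hm gh.1 gh.2⟩

theorem restriction_H2π_eq_zero_iff (M : Rep.{0} ℤ G) (D : Subgroup G)
    (x : groupCohomology.cocycles₂ M) :
    (restriction M D 2).hom (groupCohomology.H2π M x) = 0 ↔
      ∃ m : D → M, ∀ g h : D, M.ρ g (m h) - m (g * h) + m g = x ((g : G), (h : G)) := by
  have h1 : (restriction M D 2).hom (groupCohomology.H2π M x) =
      groupCohomology.H2π (Rep.res D.subtype M)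
        (groupCohomology.mapCocycles₂ D.subtype (𝟙 (Rep.res D.subtype M)) x) :=
    groupCohomology.H2π_comp_map_apply D.subtype (𝟙 (Rep.res D.subtype M)) x
  rw [h1, H2π_eq_zero_iff_exists]
  rfl

variable (H : Subgroup G)

/-- The embedding of `J_{G/H}` into the real functions on `G` which sends the class of `f` to
`f - f 1`. -/
def embedding : chevalleyModule H →ₗ[ℤ] (G → ℝ) :=
  Submodule.liftQ (LinearMap.range (diag H).hom.toLinearMap)
    ({ toFun := fun f x => ((f.1 x - f.1 1 : ℤ) : ℝ)
       map_add' := fun f f' => by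
        ext x
        change (((f.1 x + f'.1 x) - (f.1 1 + f'.1 1) : ℤ) : ℝ) =
          ((f.1 x - f.1 1 : ℤ) : ℝ) + ((f'.1 x - f'.1 1 : ℤ) : ℝ)
        push_cast; ring
       map_smul' := fun c f => by
        ext x
        change ((c * f.1 x - c * f.1 1 : ℤ) : ℝ) = c • ((f.1 x - f.1 1 : ℤ) : ℝ)
        rw [zsmul_eq_mul]; push_cast; ring } : indZ H →ₗ[ℤ] (G → ℝ))
    (by
      rintro _ ⟨n, rfl⟩
      rw [LinearMap.mem_ker]
      ext x
      change ((n - n : ℤ) : ℝ) = 0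
      simp)

/-- The class in `J_{G/H}` of a function on `H \ G`. -/
def mkFun (f : indZ H) : chevalleyModule H :=
  (Submodule.mkQ (LinearMap.range (diag H).hom.toLinearMap)) f

theorem mkFun_surjective : Function.Surjective (mkFun H) :=
  Submodule.mkQ_surjective _

theorem embedding_mkFun (f : indZ H) (x : G) :
    embedding H (mkFun H f) x = ((f.1 x - f.1 1 : ℤ) : ℝ) := rfl

theorem embedding_injective : Function.Injective (embedding H) := by
  rw [injective_iff_map_eq_zero]
  intro j hj
  obtain ⟨f, rfl⟩ := mkFun_surjective H j
  have hf : ∀ x, f.1 x = f.1 1 := fun x => by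
    have := congrFun hj x
    rw [embedding_mkFun] at this
    exact sub_eq_zero.1 (Int.cast_eq_zero.1 this)
  refine (Submodule.Quotient.mk_eq_zero _).2 ⟨f.1 1, ?_⟩
  apply Subtype.ext
  funext x
  exact (hf x).symm

/-- Translating by `g` moves the base point, so the value at `g` is subtracted to restore the
normalization at `1`. -/
theorem embedding_ρ (g : G) (j : chevalleyModule H) (x : G) :
    embedding H ((chevalleyModule H).ρ g j) x = embedding H j (x * g) - embedding H j g := by
  obtain ⟨f, rfl⟩ := mkFun_surjective H j
  change ((f.1 (x * g) - f.1 (1 * g) : ℤ) : ℝ) =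
    ((f.1 (x * g) - f.1 1 : ℤ) : ℝ) - ((f.1 g - f.1 1 : ℤ) : ℝ)
  rw [one_mul]; push_cast; ring

theorem embedding_one (j : chevalleyModule H) : embedding H j 1 = 0 := by
  obtain ⟨f, rfl⟩ := mkFun_surjective H j
  rw [embedding_mkFun, sub_self, Int.cast_zero]

theorem embedding_mul_left (j : chevalleyModule H) (h : G) (hh : h ∈ H) (x : G) :
    embedding H j (h * x) = embedding H j x := by
  obtain ⟨f, rfl⟩ := mkFun_surjective H j
  have : f.1 (h * x) = f.1 x := f.2 ⟨h, hh⟩ x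
  rw [embedding_mkFun, embedding_mkFun, this]

theorem embedding_coe (j : chevalleyModule H) (x : G) :
    ((embedding H j x : ℝ) : UnitAddCircle) = 0 := by
  obtain ⟨f, rfl⟩ := mkFun_surjective H j
  rw [embedding_mkFun, AddCircle.coe_eq_zero_iff]
  exact ⟨_, by rw [zsmul_eq_mul, mul_one]⟩

theorem exists_embedding_eq (F : G → ℝ) (h1 : F 1 = 0) (hH : ∀ h ∈ H, ∀ x, F (h * x) = F x)
    (hF : ∀ x, ((F x : ℝ) : UnitAddCircle) = 0) : ∃ j, embedding H j = F := by
  have hF' : ∀ x, ∃ n : ℤ, (n : ℝ) = F x := fun x => by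
    obtain ⟨n, hn⟩ := (AddCircle.coe_eq_zero_iff (1 : ℝ)).1 (hF x)
    exact ⟨n, by rw [← hn, zsmul_eq_mul, mul_one]⟩
  choose n hn using hF'
  refine ⟨mkFun H ⟨n, fun h x => ?_⟩, ?_⟩
  · change n (h * x) = n x
    have : (n (h * x) : ℝ) = n x := by rw [hn, hn, hH _ h.2]
    exact_mod_cast this
  · funext x
    rw [embedding_mkFun]
    push_cast
    rw [hn, hn, h1, sub_zero]

theorem exists_lift (φ : G → UnitAddCircle) (hφ : ∀ h ∈ H, ∀ x, φ (h * x) = φ x) :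
    ∃ ψ : G → ℝ, (∀ h ∈ H, ∀ x, ψ (h * x) = ψ x) ∧ ∀ x, ((ψ x : ℝ) : UnitAddCircle) = φ x := by
  -- The representative depends only on the value of `φ`, so invariance under `H` is automatic.
  refine ⟨fun x => Quotient.out (φ x), fun h hh x => by simp only [hφ h hh], fun x => ?_⟩
  exact Quotient.out_eq' (φ x)

variable {A : Type*} [AddCommGroup A]

/-- A function `u : G → G → A` such that `g ↦ u g` is a `1`-cocycle of `G` with values in the
functions on `H \ G` modulo constants, each class being represented by the function that vanishes
at `1`. -/
structure IsCrossed (u : G → G → A) : Prop where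
  mul_left : ∀ g, ∀ h ∈ H, ∀ x, u g (h * x) = u g x
  one_right : ∀ g, u g 1 = 0
  mul : ∀ g h x, u (g * h) x = u g x + u h (x * g) - u h g

/-- The cochain `u` is, on the subgroup `D`, the coboundary of a function on `H \ G`. -/
def IsTrivialOn (D : Subgroup G) (u : G → G → A) : Prop :=
  ∃ φ : G → A, (∀ h ∈ H, ∀ x, φ (h * x) = φ x) ∧
    ∀ g ∈ D, ∀ x, u g x = φ (x * g) - φ x - φ g + φ 1

/-- A real cochain on a subgroup satisfying the cocycle identity is a coboundary. -/
theorem exists_eq_coboundary_of_cocycle [Finite G] (D : Subgroup G) (w : D → G → ℝ)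
    (hH : ∀ g, ∀ h ∈ H, ∀ x, w g (h * x) = w g x)
    (hmul : ∀ g h : D, ∀ x, w (g * h) x = w g x + w h (x * g) - w h g) :
    ∃ φ : G → ℝ, (∀ h ∈ H, ∀ x, φ (h * x) = φ x) ∧
      ∀ (g : D) (x : G), w g x = φ (x * g) - φ x - φ g + w g 1 + φ 1 := by
  have := Fintype.ofFinite D
  set S : G → ℝ := fun x => ∑ h : D, w h x with hS
  have hc : (Fintype.card D : ℝ) ≠ 0 := by exact_mod_cast Fintype.card_ne_zero
  -- Reindex the sum by `h ↦ g * h` and expand with the cocycle identity.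
  have key : ∀ (g : D) x, S x = Fintype.card D * w g x + S (x * g) - S g := fun g x => by
    have : S x = ∑ h : D, w (g * h) x :=
      (Fintype.sum_equiv (Equiv.mulLeft g) _ _ fun _ => rfl).symm
    rw [this]
    simp only [hmul, Finset.sum_sub_distrib, Finset.sum_add_distrib, Finset.sum_const,
      Finset.card_univ, nsmul_eq_mul, hS]
  refine ⟨fun x => -(S x / Fintype.card D), fun h hh x => ?_, fun g x => ?_⟩
  · simp only [hS, hH _ h hh]
  · have h1 := key g x
    have h2 := key g 1
    rw [one_mul] at h2
    field_simp
    linarith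

/-- The real cochain whose coboundary is the `2`-cocycle `f`. -/
def realCochain [Fintype G] :
    groupCohomology.cocycles₂ (chevalleyModule H) →+ (G → G → ℝ) where
  toFun f g x := (∑ b, embedding H (f (g, b)) x) / Fintype.card G
  map_zero' := by
    funext g x
    have : ∀ b, (0 : groupCohomology.cocycles₂ (chevalleyModule H)) (g, b) = 0 := fun _ => rfl
    simp [this]
  map_add' f f' := by
    funext g x
    have : ∀ b, (f + f') (g, b) = f (g, b) + f' (g, b) := fun _ => rfl
    simp only [this, map_add, Pi.add_apply, Finset.sum_add_distrib, add_div]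

section RealCochain

variable [Fintype G] (f : groupCohomology.cocycles₂ (chevalleyModule H))

theorem realCochain_apply (g x : G) :
    realCochain H f g x = (∑ b, embedding H (f (g, b)) x) / Fintype.card G := rfl

theorem realCochain_mul_left (g : G) (h : G) (hh : h ∈ H) (x : G) :
    realCochain H f g (h * x) = realCochain H f g x := by
  simp only [realCochain_apply, embedding_mul_left H _ h hh]

theorem realCochain_one_right (g : G) : realCochain H f g 1 = 0 := by
  simp only [realCochain_apply, embedding_one, Finset.sum_const_zero, zero_div]

/-- This is the `2`-cocycle identity averaged over its last variable; left translation by `h` does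
not change the average. -/
theorem realCochain_mul (g h x : G) :
    realCochain H f (g * h) x = realCochain H f g x +
      realCochain H f h (x * g) - realCochain H f h g - embedding H (f (g, h)) x := by
  have hc : (Fintype.card G : ℝ) ≠ 0 := by exact_mod_cast Fintype.card_ne_zero
  have key : ∀ b, embedding H (f (g * h, b)) x + embedding H (f (g, h)) x =
      embedding H (f (h, b)) (x * g) - embedding H (f (h, b)) g +
        embedding H (f (g, h * b)) x := fun b => by
    have := congrArg (fun j => embedding H j x)
      ((groupCohomology.mem_cocycles₂_iff (f : G × G → chevalleyModule H)).1 f.2 g h b)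
    simpa only [map_add, Pi.add_apply, embedding_ρ] using this
  have hsum := Finset.sum_congr rfl fun b (_ : b ∈ Finset.univ) => key b
  rw [Finset.sum_add_distrib, Finset.sum_add_distrib, Finset.sum_sub_distrib, Finset.sum_const,
    Finset.card_univ, nsmul_eq_mul] at hsum
  have hs : ∑ b, embedding H (f (g, h * b)) x = ∑ b, embedding H (f (g, b)) x :=
    Fintype.sum_equiv (Equiv.mulLeft h) _ _ fun _ => rfl
  rw [hs] at hsum
  simp only [realCochain_apply]
  field_simp
  linarith

/-- The cochain with values in `ℝ / ℤ` attached to a `2`-cocycle of `J_{G/H}`. -/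
def circleCochain : groupCohomology.cocycles₂ (chevalleyModule H) →+ (G → G → UnitAddCircle) where
  toFun f g x := ((realCochain H f g x : ℝ) : UnitAddCircle)
  map_zero' := by funext g x; simp
  map_add' f f' := by funext g x; simp

theorem circleCochain_apply (g x : G) :
    circleCochain H f g x = ((realCochain H f g x : ℝ) : UnitAddCircle) := rfl

theorem isCrossed_circleCochain : IsCrossed H (circleCochain H f) where
  mul_left g h hh x := by rw [circleCochain_apply, realCochain_mul_left H f g h hh]; rfl
  one_right g := by rw [circleCochain_apply, realCochain_one_right]; rfl
  mul g h x := by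
    simp only [circleCochain_apply, realCochain_mul, AddCircle.coe_sub, AddCircle.coe_add,
      embedding_coe, sub_zero]

/-- Two real cochains on `D` with coboundary `f` differ by a real cocycle, hence by a real
coboundary. An integral primitive of `f` thus exists exactly when `realCochain` is a coboundary
modulo `1`. -/
theorem exists_cochain_iff (D : Subgroup G) :
    (∃ m : D → chevalleyModule H, ∀ g h : D,
      (chevalleyModule H).ρ g (m h) - m (g * h) + m g = f ((g : G), (h : G))) ↔
    IsTrivialOn H D (circleCochain H f) := by
  constructor
  · rintro ⟨m, hm⟩
    have hm' : ∀ (g h : D) (x : G), embedding H (m h) (x * g) - embedding H (m h) g -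
        embedding H (m (g * h)) x + embedding H (m g) x = embedding H (f (g, h)) x :=
      fun g h x => by
        rw [← hm g h, map_add, map_sub, Pi.add_apply, Pi.sub_apply, embedding_ρ]
    obtain ⟨φ, hφ, hw⟩ := exists_eq_coboundary_of_cocycle H D
      (fun g x => realCochain H f g x - embedding H (m g) x)
      (fun g h hh x => by
        rw [realCochain_mul_left H f g h hh, embedding_mul_left H _ h hh])
      (fun g h x => by
        have := realCochain_mul H f g h x
        have := hm' g h x
        rw [Subgroup.coe_mul]
        linarith)
    refine ⟨fun x => (φ x : ℝ), fun h hh x => by simp only [hφ h hh], fun g hg x => ?_⟩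
    have h1 := hw ⟨g, hg⟩ x
    simp only [realCochain_one_right, embedding_one, sub_zero, add_zero] at h1
    have h2 : realCochain H f g x = embedding H (m ⟨g, hg⟩) x +
      (φ (x * g) - φ x - φ g + φ 1) := by linarith
    rw [circleCochain_apply, h2, AddCircle.coe_add, embedding_coe, zero_add]
    simp
  · rintro ⟨φ, hφ, hu⟩
    obtain ⟨ψ, hψ, hψφ⟩ := exists_lift H φ hφ
    have hex : ∀ g : D, ∃ j, embedding H j = fun x =>
        realCochain H f g x - (ψ (x * g) - ψ x - ψ g + ψ 1) := fun g => by
      apply exists_embedding_eq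
      · rw [realCochain_one_right, one_mul]; ring
      · intro h hh x
        rw [realCochain_mul_left H f g h hh, mul_assoc, hψ h hh, hψ h hh]
      · intro x
        have := hu g g.2 x
        rw [circleCochain_apply] at this
        simp [this, hψφ]
    choose m hm using hex
    refine ⟨m, fun g h => embedding_injective H ?_⟩
    funext x
    have := realCochain_mul H f g h x
    rw [map_add, map_sub, Pi.add_apply, Pi.sub_apply, embedding_ρ]
    simp only [hm, Subgroup.coe_mul, mul_assoc]
    linarith

/-- Every cocycle modulo constants with values in `ℝ / ℤ` comes, up to a coboundary, from a
`2`-cocycle of `J_{G/H}`. -/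
theorem exists_circleCochain_eq (u : G → G → UnitAddCircle) (hu : IsCrossed H u) :
    ∃ f, IsTrivialOn H ⊤ (circleCochain H f - u) := by
  have hex : ∀ g, ∃ ψ : G → ℝ, (∀ h ∈ H, ∀ x, ψ (h * x) = ψ x) ∧
      ∀ x, ((ψ x : ℝ) : UnitAddCircle) = u g x := fun g => exists_lift H (u g) (hu.mul_left g)
  choose w hwH hwu using hex
  have hw1 : ∀ g, ((w g 1 : ℝ) : UnitAddCircle) = 0 := fun g => by rw [hwu, hu.one_right]
  -- The connecting homomorphism: the coboundary of the normalized real lift of `u` is integral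
  -- because `u` satisfies the cocycle identity modulo `1`.
  have hex2 : ∀ gh : G × G, ∃ j, embedding H j = fun x =>
      w gh.2 (x * gh.1) - w gh.2 gh.1 - (w (gh.1 * gh.2) x - w (gh.1 * gh.2) 1) +
        (w gh.1 x - w gh.1 1) := fun gh => by
    apply exists_embedding_eq
    · rw [one_mul]; ring
    · intro h hh x
      rw [mul_assoc, hwH _ h hh, hwH _ h hh, hwH _ h hh]
    · intro x
      simp only [AddCircle.coe_add, AddCircle.coe_sub, hwu, hu.one_right, hu.mul]
      abel
  choose F hF using hex2
  have hFc : F ∈ groupCohomology.cocycles₂ (chevalleyModule H) := by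
    rw [groupCohomology.mem_cocycles₂_iff]
    intro g h j
    apply embedding_injective H
    funext x
    rw [map_add, map_add, Pi.add_apply, Pi.add_apply, embedding_ρ]
    simp only [hF, mul_assoc]
    ring
  refine ⟨⟨F, hFc⟩, ?_⟩
  -- The averaged cochain and the lift of `u` have the same coboundary `F`, so their difference is a
  -- real cocycle.
  obtain ⟨φ, hφ, hw⟩ := exists_eq_coboundary_of_cocycle H ⊤
      (fun g x => realCochain H ⟨F, hFc⟩ g x - (w g x - w g 1))
      (fun g h hh x => by
        rw [realCochain_mul_left H _ g h hh, hwH _ h hh])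
      (fun g h x => by
        have h1 := realCochain_mul H ⟨F, hFc⟩ g h x
        have h2 : embedding H ((⟨F, hFc⟩ : groupCohomology.cocycles₂ (chevalleyModule H))
          ((g : G), (h : G))) x = _ := congrFun (hF ((g : G), (h : G))) x
        rw [h2] at h1
        simp only [Subgroup.coe_mul] at *
        linarith)
  refine ⟨fun x => (φ x : ℝ), fun h hh x => by simp only [hφ h hh], fun g hg x => ?_⟩
  have h1 := hw ⟨g, hg⟩ x
  simp only [realCochain_one_right, sub_self, add_zero] at h1
  have h2 : realCochain H ⟨F, hFc⟩ g x = (w g x - w g 1) +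
    (φ (x * g) - φ x - φ g + φ 1) := by linarith
  rw [Pi.sub_apply, Pi.sub_apply, circleCochain_apply, h2, ← hwu]
  simp [hw1]

theorem H2π_eq_zero_iff_isTrivialOn :
    groupCohomology.H2π (chevalleyModule H) f = 0 ↔ IsTrivialOn H ⊤ (circleCochain H f) := by
  rw [H2π_eq_zero_iff_exists, ← exists_cochain_iff]
  constructor
  · rintro ⟨m, hm⟩
    exact ⟨fun g => m g, fun g h => hm g h⟩
  · rintro ⟨m, hm⟩
    exact ⟨fun g => m ⟨g, trivial⟩, fun g h => hm ⟨g, trivial⟩ ⟨h, trivial⟩⟩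

theorem H2π_mem_shaOmega_iff :
    groupCohomology.H2π (chevalleyModule H) f ∈ shaOmega (chevalleyModule H) ↔
      ∀ D : Subgroup G, IsCyclic D → IsTrivialOn H D (circleCochain H f) := by
  simp only [shaOmega, sha, Submodule.mem_iInf, Set.mem_ofPred_eq, LinearMap.mem_ker,
    ← exists_cochain_iff]
  exact forall₂_congr fun D _ => restriction_H2π_eq_zero_iff _ D f

end RealCochain

end Bridge


/-! ### Cocycles of `V ⋊ K` with values in functions on `V` modulo constants -/

section SemidirectProduct

variable {V K A : Type} [AddCommGroup V] [Group K] [AddCommGroup A]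
  {φ : K →* MulAut (Multiplicative V)}

/-- The right action of `V ⋊ K` on `V`, identified with the right cosets of `K`. -/
def rAct (g : Multiplicative V ⋊[φ] K) (x : V) : V :=
  ((φ g.right)⁻¹ (Multiplicative.ofAdd x * g.left)).toAdd

theorem rAct_mul (g h : Multiplicative V ⋊[φ] K) (x : V) :
    rAct (g * h) x = rAct h (rAct g x) := by
  simp only [rAct, SemidirectProduct.mul_left, SemidirectProduct.mul_right, map_mul, mul_inv_rev,
    MulAut.mul_apply, ofAdd_toAdd, MulAut.inv_apply_self, mul_assoc]

theorem rAct_one (x : V) : rAct (1 : Multiplicative V ⋊[φ] K) x = x := by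
  simp [rAct]

theorem rAct_inl (v : Multiplicative V) (x : V) :
    rAct (SemidirectProduct.inl v : Multiplicative V ⋊[φ] K) x = x + v.toAdd := by
  simp [rAct]

theorem rAct_inr (k : K) (x : V) :
    rAct (SemidirectProduct.inr k : Multiplicative V ⋊[φ] K) x =
      ((φ k)⁻¹ (Multiplicative.ofAdd x)).toAdd := by
  simp [rAct]

theorem rAct_inr_zero (k : K) :
    rAct (SemidirectProduct.inr k : Multiplicative V ⋊[φ] K) 0 = 0 := by
  simp [rAct]

/-- Every right coset of `K` contains exactly one element of `V`, here the image of `0`; this turns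
`K`-invariant functions on the group into functions on `V`. -/
theorem inr_mul_inl_rAct (x : Multiplicative V ⋊[φ] K) :
    SemidirectProduct.inr x.right *
      SemidirectProduct.inl (Multiplicative.ofAdd (rAct x 0)) = x := by
  ext <;> simp [rAct]

/-- A cocycle of `V ⋊ K` with values in the functions on `V` modulo constants, each class being
represented by the function that vanishes at `0`. -/
structure IsCocycle (U : Multiplicative V ⋊[φ] K → V → A) : Prop where
  zero_right : ∀ g, U g 0 = 0
  mul : ∀ g h x, U (g * h) x = U g x + U h (rAct g x) - U h (rAct g 0)

/-- The coboundary of a function on `V`. -/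
def coboundary (φ : K →* MulAut (Multiplicative V)) (ψ : V → A)
    (g : Multiplicative V ⋊[φ] K) (x : V) : A :=
  ψ (rAct g x) - ψ x - ψ (rAct g 0) + ψ 0

/-- The cochain `U` is a coboundary on the subgroup `D`. -/
def IsCoboundaryOn (D : Subgroup (Multiplicative V ⋊[φ] K))
    (U : Multiplicative V ⋊[φ] K → V → A) : Prop :=
  ∃ ψ : V → A, ∀ g ∈ D, ∀ x, U g x = coboundary φ ψ g x

theorem isCocycle_coboundary (ψ : V → A) : IsCocycle (coboundary φ ψ) where
  zero_right g := by simp only [coboundary]; abel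
  mul g h x := by simp only [coboundary, rAct_mul]; abel

theorem IsCocycle.sub {U U' : Multiplicative V ⋊[φ] K → V → A} (hU : IsCocycle U)
    (hU' : IsCocycle U') : IsCocycle (U - U') where
  zero_right g := by simp [hU.zero_right, hU'.zero_right]
  mul g h x := by simp only [Pi.sub_apply, hU.mul, hU'.mul]; abel

theorem IsCocycle.one {U : Multiplicative V ⋊[φ] K → V → A} (hU : IsCocycle U) (x : V) :
    U 1 x = 0 := by
  have := hU.mul 1 1 x
  rw [one_mul, rAct_one, rAct_one, hU.zero_right, sub_zero] at this
  exact left_eq_add.1 this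

theorem IsCocycle.inv_eq_zero {U : Multiplicative V ⋊[φ] K → V → A} (hU : IsCocycle U)
    {g : Multiplicative V ⋊[φ] K} (hg : ∀ x, U g x = 0) (x : V) : U g⁻¹ x = 0 := by
  have h1 := hU.mul g g⁻¹ (rAct g⁻¹ x)
  rw [mul_inv_cancel, hU.one, hg, zero_add, ← rAct_mul, inv_mul_cancel, rAct_one] at h1
  have h2 := hU.mul g g⁻¹ (rAct g⁻¹ 0)
  rw [mul_inv_cancel, hU.one, hg, zero_add, ← rAct_mul, inv_mul_cancel, rAct_one,
    hU.zero_right, zero_sub] at h2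
  rw [neg_eq_zero.1 h2.symm, sub_zero] at h1
  exact h1.symm

/-- A cocycle that is a coboundary at `g` is a coboundary on the subgroup generated by `g`. -/
theorem IsCocycle.isCoboundaryOn_zpowers {U : Multiplicative V ⋊[φ] K → V → A}
    (hU : IsCocycle U) (g : Multiplicative V ⋊[φ] K) (ψ : V → A)
    (h : ∀ x, U g x = coboundary φ ψ g x) : IsCoboundaryOn (Subgroup.zpowers g) U := by
  have hW := hU.sub (isCocycle_coboundary (φ := φ) ψ)
  refine ⟨ψ, fun d hd => ?_⟩
  rw [Subgroup.zpowers_eq_closure] at hd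
  suffices ∀ x, (U - coboundary φ ψ) d x = 0 from fun x => sub_eq_zero.1 (this x)
  induction hd using Subgroup.closure_induction with
  | mem y hy =>
    rw [Set.mem_singleton_iff.1 hy]
    exact fun x => sub_eq_zero.2 (h x)
  | one => exact hW.one
  | mul y z _ _ hy hz => exact fun x => by rw [hW.mul, hy, hz, hz]; simp
  | inv y _ hy => exact hW.inv_eq_zero hy

/-- Passage from functions on the group to functions on `V`. -/
theorem IsCrossed.isCocycle {u : Multiplicative V ⋊[φ] K → Multiplicative V ⋊[φ] K → A}
    (hu : IsCrossed (SemidirectProduct.inr : K →* Multiplicative V ⋊[φ] K).range u) :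
    IsCocycle fun g y => u g (SemidirectProduct.inl (Multiplicative.ofAdd y)) := by
  have key : ∀ g x, u g (SemidirectProduct.inl (Multiplicative.ofAdd (rAct x 0))) = u g x :=
    fun g x => by
      conv_rhs => rw [← inr_mul_inl_rAct x]
      rw [hu.mul_left _ _ ⟨_, rfl⟩]
  refine ⟨fun g => ?_, fun g h x => ?_⟩
  · rw [ofAdd_zero, map_one, hu.one_right]
  · have : rAct g x = rAct (SemidirectProduct.inl (Multiplicative.ofAdd x) * g) 0 := by
      rw [rAct_mul, rAct_inl, zero_add, toAdd_ofAdd]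
    simp only [hu.mul, this, key]

theorem IsCocycle.isCrossed {U : Multiplicative V ⋊[φ] K → V → A} (hU : IsCocycle U) :
    IsCrossed (SemidirectProduct.inr : K →* Multiplicative V ⋊[φ] K).range
      fun g x => U g (rAct x 0) where
  mul_left g h hh x := by
    obtain ⟨k, rfl⟩ := hh
    rw [rAct_mul, rAct_inr_zero]
  one_right g := by rw [rAct_one, hU.zero_right]
  mul g h x := by rw [hU.mul, rAct_mul]

theorem isTrivialOn_iff (D : Subgroup (Multiplicative V ⋊[φ] K))
    {u : Multiplicative V ⋊[φ] K → Multiplicative V ⋊[φ] K → A}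
    (hu : IsCrossed (SemidirectProduct.inr : K →* Multiplicative V ⋊[φ] K).range u) :
    IsTrivialOn (SemidirectProduct.inr : K →* Multiplicative V ⋊[φ] K).range D u ↔
      IsCoboundaryOn D fun g y => u g (SemidirectProduct.inl (Multiplicative.ofAdd y)) := by
  constructor
  · rintro ⟨ψ, hψ, h⟩
    have key : ∀ x, ψ (SemidirectProduct.inl (Multiplicative.ofAdd (rAct x 0))) = ψ x :=
      fun x => by
        conv_rhs => rw [← inr_mul_inl_rAct x]
        rw [hψ _ ⟨_, rfl⟩]
    refine ⟨fun y => ψ (SemidirectProduct.inl (Multiplicative.ofAdd y)), fun g hg x => ?_⟩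
    have : rAct g x = rAct (SemidirectProduct.inl (Multiplicative.ofAdd x) * g) 0 := by
      rw [rAct_mul, rAct_inl, zero_add, toAdd_ofAdd]
    simp only [coboundary, this, key, h g hg, ofAdd_zero, map_one]
  · rintro ⟨ψ, h⟩
    refine ⟨fun x => ψ (rAct x 0), ?_, fun g hg x => ?_⟩
    · rintro _ ⟨k, rfl⟩ x
      simp only [rAct_mul, rAct_inr_zero]
    · have := h g hg (rAct x 0)
      simp only [coboundary, ← rAct_mul] at this
      simp only [rAct_one]
      rw [← this]
      conv_lhs => rw [← inr_mul_inl_rAct x]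
      rw [hu.mul_left _ _ ⟨_, rfl⟩]

end SemidirectProduct

/-! ### Factor sets, their splitting and their commutator pairing -/

section Splitting

variable {V A : Type} [AddCommGroup V] [AddCommGroup A]

/-- The extension of `V` by `A` defined by a factor set `c`. -/
@[ext]
structure FactorExtension (c : V → V → A) where
  fst : A
  snd : V

namespace FactorExtension

variable (c : V → V → A)

instance : Add (FactorExtension c) := ⟨fun x y => ⟨x.1 + y.1 + c x.2 y.2, x.2 + y.2⟩⟩
instance : Zero (FactorExtension c) := ⟨⟨0, 0⟩⟩
instance : Neg (FactorExtension c) := ⟨fun x => ⟨-x.1 - c x.2 (-x.2), -x.2⟩⟩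

variable {c}

theorem fst_add (x y : FactorExtension c) : (x + y).1 = x.1 + y.1 + c x.2 y.2 := rfl
theorem snd_add (x y : FactorExtension c) : (x + y).2 = x.2 + y.2 := rfl
theorem fst_zero : (0 : FactorExtension c).1 = 0 := rfl
theorem snd_zero : (0 : FactorExtension c).2 = 0 := rfl
theorem fst_neg (x : FactorExtension c) : (-x).1 = -x.1 - c x.2 (-x.2) := rfl
theorem snd_neg (x : FactorExtension c) : (-x).2 = -x.2 := rfl

/-- The extension attached to a symmetric factor set is an abelian group. -/
abbrev addCommGroup (h0 : ∀ v, c v 0 = 0)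
    (hm : ∀ v w x, c (v + w) x = c v x + c w (x + v) - c w v) (hs : ∀ v w, c v w = c w v) :
    AddCommGroup (FactorExtension c) :=
  { AddGroup.ofLeftAxioms (G := FactorExtension c)
      (fun x y z => by
        ext
        · simp only [fst_add, snd_add]
          rw [add_comm x.2 y.2, hm, add_comm z.2 y.2, hs x.2 y.2]; abel
        · simp only [snd_add, add_assoc])
      (fun x => by
        ext
        · simp only [fst_add, fst_zero, snd_zero]
          rw [hs, h0]; simp
        · simp only [snd_add, snd_zero, zero_add])
      (fun x => by
        ext
        · simp only [fst_add, fst_neg, snd_neg, fst_zero]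
          rw [hs (-x.2)]; abel
        · simp only [snd_add, snd_neg, snd_zero, neg_add_cancel]) with
    add_comm := fun x y => by
      ext
      · simp only [fst_add]; rw [hs, add_comm x.1]
      · simp only [snd_add, add_comm] }

end FactorExtension

/-- A symmetric factor set with values in a divisible group is a coboundary. -/
theorem exists_splitting [DivisibleBy A ℤ] {c : V → V → A} (h0 : ∀ v, c v 0 = 0)
    (hm : ∀ v w x, c (v + w) x = c v x + c w (x + v) - c w v) (hs : ∀ v w, c v w = c w v) :
    ∃ ψ : V → A, ψ 0 = 0 ∧ ∀ v x, c v x = ψ (x + v) - ψ x - ψ v := by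
  let := FactorExtension.addCommGroup h0 hm hs
  let f : A →+ FactorExtension c :=
    { toFun := fun a => ⟨a, 0⟩
      map_zero' := rfl
      map_add' := fun a b => by
        ext
        · rw [FactorExtension.fst_add]; simp [h0]
        · rw [FactorExtension.snd_add]; simp }
  -- Divisible groups are injective, so the inclusion of `A` in the abelian extension has a
  -- retraction `r`; the splitting is `-r` on the section `v ↦ (0, v)`.
  obtain ⟨r, hr⟩ := (Module.Baer.of_divisible A).extension_property_addMonoidHom f
    (fun a b hab => congrArg FactorExtension.fst hab) (AddMonoidHom.id A)
  have hr' : ∀ a, r ⟨a, 0⟩ = a := fun a => DFunLike.congr_fun hr a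
  refine ⟨fun v => -r ⟨0, v⟩, neg_eq_zero.2 (hr' 0), fun v x => ?_⟩
  have h1 : (⟨c v x, 0⟩ : FactorExtension c) + ⟨0, x + v⟩ = ⟨0, v⟩ + ⟨0, x⟩ := by
    ext
    · simp only [FactorExtension.fst_add]
      rw [hs 0, h0]; simp
    · simp only [FactorExtension.snd_add]
      rw [zero_add, add_comm]
  have h2 := congrArg r h1
  rw [map_add, map_add, hr'] at h2
  change c v x = -r _ - -r _ - -r _
  rw [eq_sub_of_add_eq h2]; abel

/-- The commutator pairing of a factor set is additive. -/
theorem commutator_add_left {c : V → V → A}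
    (hm : ∀ v w x, c (v + w) x = c v x + c w (x + v) - c w v) (v v' w : V) :
    c (v + v') w - c w (v + v') = (c v w - c w v) + (c v' w - c w v') := by
  have h1 := hm v v' w
  have h2 := hm w v' v
  have h3 := hm v' w v
  -- Commutativity of `V` gives two expansions of `c (v' + w) v`; comparing them yields additivity.
  rw [add_comm w v', h3] at h2
  rw [← sub_eq_zero, add_comm v w] at h2
  rw [h1]
  refine sub_eq_zero.1 (neg_eq_zero.1 (Eq.trans ?_ h2))
  abel

/-- The commutator pairing of a factor set. -/
def commutatorPairing {c : V → V → A}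
    (hm : ∀ v w x, c (v + w) x = c v x + c w (x + v) - c w v) : V →+ V →+ A :=
  AddMonoidHom.mk' (fun v => AddMonoidHom.mk' (fun w => c v w - c w v) fun w w' => by
    have := commutator_add_left hm w w' v
    rw [← neg_inj, neg_sub, this]; abel)
    fun v v' => by ext w; exact commutator_add_left hm v v' w

end Splitting

/-! ### Alternating pairings on the plane -/

section Plane

variable {p : ℕ} {A : Type} [AddCommGroup A] [NeZero p]

theorem eq_val_nsmul_add (v : Fin 2 → ZMod p) :
    v = (v 0).val • Pi.single 0 1 + (v 1).val • Pi.single 1 1 := by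
  ext i
  rw [Pi.add_apply, Pi.smul_apply, Pi.smul_apply, nsmul_eq_mul, nsmul_eq_mul,
    ZMod.natCast_zmod_val, ZMod.natCast_zmod_val]
  fin_cases i <;> simp

/-- An alternating pairing on `𝔽_p²` that vanishes on the standard basis is zero. -/
theorem pairing_eq_zero (β : (Fin 2 → ZMod p) →+ (Fin 2 → ZMod p) →+ A) (halt : ∀ v, β v v = 0)
    (h : β (Pi.single 0 1) (Pi.single 1 1) = 0) (v w : Fin 2 → ZMod p) : β v w = 0 := by
  have h' : β (Pi.single 1 1) (Pi.single 0 1) = 0 := by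
    have := halt (Pi.single 0 1 + Pi.single 1 1)
    simpa [halt, h] using this
  rw [eq_val_nsmul_add v, eq_val_nsmul_add w]
  simp only [map_add, map_nsmul, AddMonoidHom.add_apply, AddMonoidHom.nsmul_apply, halt, h, h',
    smul_zero, add_zero]

end Plane


/-! ### Locally trivial classes of subgroups of `SL₂(𝔽_p)` in the dual of the plane -/

section SL2

open Matrix.SpecialLinearGroup (toLin')

theorem toLin'_mul_inv {p : ℕ} {K : Type} [Group K] (ι : K →* SL(2, ZMod p))
    (k k' : K) (x : Fin 2 → ZMod p) :
    toLin' (ι (k * k')⁻¹) x = toLin' (ι k'⁻¹) (toLin' (ι k⁻¹) x) := by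
  rw [mul_inv_rev, map_mul, map_mul]; rfl

variable {p : ℕ} [Fact p.Prime]

/-- The standard symplectic form on `𝔽_p²`. -/
def symp (v w : Fin 2 → ZMod p) : ZMod p := v 0 * w 1 - v 1 * w 0

theorem symp_toLin' (M : SL(2, ZMod p)) (v w : Fin 2 → ZMod p) :
    symp (toLin' M v) (toLin' M w) = symp v w := by
  have hM := M.2
  rw [Matrix.det_fin_two] at hM
  simp only [symp, Matrix.SpecialLinearGroup.toLin'_apply, Matrix.toLin'_apply, Matrix.mulVec,
    dotProduct, Fin.sum_univ_two]
  linear_combination (v 0 * w 1 - v 1 * w 0) * hM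

theorem symp_add_left (v v' w : Fin 2 → ZMod p) : symp (v + v') w = symp v w + symp v' w := by
  simp only [symp, Pi.add_apply]; ring

theorem symp_add_right (v w w' : Fin 2 → ZMod p) : symp v (w + w') = symp v w + symp v w' := by
  simp only [symp, Pi.add_apply]; ring

theorem symp_smul_left (a : ZMod p) (v w : Fin 2 → ZMod p) : symp (a • v) w = a * symp v w := by
  simp only [symp, Pi.smul_apply, smul_eq_mul]; ring

theorem symp_smul_right (a : ZMod p) (v w : Fin 2 → ZMod p) : symp v (a • w) = a * symp v w := by
  simp only [symp, Pi.smul_apply, smul_eq_mul]; ring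

theorem exists_symp_eq_one {e : Fin 2 → ZMod p} (he : e ≠ 0) : ∃ f, symp e f = 1 := by
  by_cases h0 : e 0 = 0
  · have h1 : e 1 ≠ 0 := fun h1 => he (by ext i; fin_cases i <;> simp [h0, h1])
    exact ⟨![-(e 1)⁻¹, 0], by simp [symp, h1]⟩
  · exact ⟨![0, (e 0)⁻¹], by simp [symp, h0]⟩

theorem eq_symp_smul_add {e f : Fin 2 → ZMod p} (h : symp e f = 1) (x : Fin 2 → ZMod p) :
    x = symp x f • e + symp e x • f := by
  simp only [symp] at h ⊢
  ext i
  fin_cases i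
  · simp; linear_combination (- x 0) * h
  · simp; linear_combination (- x 1) * h

/-- A `p`-subgroup of `SL₂(𝔽_p)` fixes a nonzero vector. -/
theorem exists_fixed_vector {P : Type} [Group P] (hP : IsPGroup p P)
    (ι : P →* SL(2, ZMod p)) : ∃ e : Fin 2 → ZMod p, e ≠ 0 ∧ ∀ q, toLin' (ι q) e = e := by
  let : MulAction P (Fin 2 → ZMod p) :=
    { smul := fun q v => toLin' (ι q) v
      one_smul := fun v => by
        change toLin' (ι 1) v = v
        rw [map_one, map_one]; rfl
      mul_smul := fun q q' v => by
        change toLin' (ι (q * q')) v = toLin' (ι q) (toLin' (ι q') v)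
        rw [map_mul, map_mul]; rfl }
  -- The plane has `p²` points and `0` is fixed, so counting orbits modulo `p` gives another fixed
  -- point.
  obtain ⟨e, he, he0⟩ := hP.exists_fixed_point_of_prime_dvd_card_of_fixed_point (Fin 2 → ZMod p)
    (by simp [Nat.card_eq_fintype_card]) (a := 0) (fun q => map_zero (toLin' (ι q)))
  exact ⟨e, Ne.symm he0, he⟩

section FirstCohomology

variable {K A : Type} [Group K] [AddCommGroup A] (ι : K →* SL(2, ZMod p))

/-- The `1`-cocycles of `K` with values in the dual `Hom(𝔽_p², A)`. -/
def IsDualCocycle (c : K → (Fin 2 → ZMod p) →+ A) : Prop :=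
  ∀ k k' x, c (k * k') x = c k x + c k' (toLin' (ι k⁻¹) x)

/-- The coboundary of a linear form. -/
def dualCoboundary (ψ : (Fin 2 → ZMod p) →+ A) (k : K) : (Fin 2 → ZMod p) →+ A :=
  ψ.comp (toLin' (ι k⁻¹)).toLinearMap.toAddMonoidHom - ψ

theorem dualCoboundary_apply (ψ : (Fin 2 → ZMod p) →+ A) (k : K) (x : Fin 2 → ZMod p) :
    dualCoboundary ι ψ k x = ψ (toLin' (ι k⁻¹) x) - ψ x := rfl

theorem isDualCocycle_dualCoboundary (ψ : (Fin 2 → ZMod p) →+ A) :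
    IsDualCocycle ι (dualCoboundary ι ψ) := fun k k' x => by
  simp only [dualCoboundary_apply, toLin'_mul_inv]; abel

variable {ι} in
theorem IsDualCocycle.sub {c c' : K → (Fin 2 → ZMod p) →+ A} (hc : IsDualCocycle ι c)
    (hc' : IsDualCocycle ι c') : IsDualCocycle ι (c - c') := fun k k' x => by
  simp only [Pi.sub_apply, AddMonoidHom.sub_apply, hc k, hc' k]; abel

/-- A locally trivial class in `H¹(P, Hom(𝔽_p², A))` is trivial for a `p`-subgroup `P` of
`SL₂(𝔽_p)`. -/
theorem exists_eq_dualCoboundary_of_isPGroup (hK : IsPGroup p K) (hι : Function.Injective ι)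
    (c : K → (Fin 2 → ZMod p) →+ A) (hc : IsDualCocycle ι c)
    (hfix : ∀ k x, toLin' (ι k) x = x → c k x = 0) :
    ∃ ψ, ∀ k, c k = dualCoboundary ι ψ k := by
  obtain ⟨e, he0, he⟩ := exists_fixed_vector hK ι
  obtain ⟨f, hef⟩ := exists_symp_eq_one he0
  have hf : ∀ q, toLin' (ι q) f = symp (toLin' (ι q) f) f • e + f := fun q => by
    have h1 := eq_symp_smul_add hef (toLin' (ι q) f)
    have h2 : symp e (toLin' (ι q) f) = 1 := by
      conv_lhs => rw [← he q]
      rw [symp_toLin', hef]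
    rwa [h2, one_smul] at h1
  -- In the basis `e, f` each `q` is the transvection `f ↦ f + t q • e`. The map `t` is an injective
  -- homomorphism to `ℤ/p`, so `K` is trivial or generated by any `q₀` with `t q₀ ≠ 0`.
  set t : K → ZMod p := fun q => symp (toLin' (ι q) f) f with ht
  have htmul : ∀ q q', t (q * q') = t q + t q' := fun q q' => by
    have : toLin' (ι (q * q')) f = toLin' (ι q) (toLin' (ι q') f) := by
      rw [map_mul, map_mul]; rfl
    simp only [ht]
    rw [this]
    conv_lhs => rw [hf q', map_add, map_smul, he, symp_add_left, symp_smul_left, hef, mul_one]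
    rw [add_comm]
  have ht1 : t 1 = 0 := by simpa using htmul 1 1
  have htinv : ∀ q, t q⁻¹ = -t q := fun q => by
    have := htmul q⁻¹ q
    rw [inv_mul_cancel, ht1] at this
    exact eq_neg_of_add_eq_zero_left this.symm
  have htinj : ∀ q q', t q = t q' → q = q' := fun q q' h => by
    apply hι
    have : ∀ x, toLin' (ι q) x = toLin' (ι q') x := fun x => by
      rw [eq_symp_smul_add hef x]
      simp only [map_add, map_smul, he]
      rw [hf q, hf q']
      change _ • e + _ • (t q • e + f) = _ • e + _ • (t q' • e + f)
      rw [h]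
    apply Matrix.SpecialLinearGroup.toLin'_injective
    exact LinearEquiv.ext this
  have htpow : ∀ q (n : ℕ), t (q ^ n) = n * t q := fun q n => by
    induction n with
    | zero => simp [ht1]
    | succ n ih => rw [pow_succ, htmul, ih]; push_cast; ring
  have hce : ∀ q (a : ZMod p), c q (a • e) = 0 := fun q a => hfix q _ (by rw [map_smul, he])
  have hcf : ∀ q q', c (q * q') f = c q f + c q' f := fun q q' => by
    rw [hc, hf, map_add, hce, zero_add]
  have hcf1 : c 1 f = 0 := by simpa using hcf 1 1
  have hcfpow : ∀ q (n : ℕ), c (q ^ n) f = n • c q f := fun q n => by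
    induction n with
    | zero => simp [hcf1]
    | succ n ih => rw [pow_succ, hcf, ih, succ_nsmul]
  have hcx : ∀ q x, c q x = (symp e x).val • c q f := fun q x => by
    conv_lhs => rw [eq_symp_smul_add hef x]
    rw [map_add, hce, zero_add, ← map_nsmul]
    congr 1
    ext i
    rw [Pi.smul_apply, Pi.smul_apply, nsmul_eq_mul, ZMod.natCast_zmod_val, smul_eq_mul]
  by_cases htriv : ∀ q, t q = 0
  · refine ⟨0, fun k => ?_⟩
    refine DFunLike.ext _ _ fun x => ?_
    have : k = 1 := htinj _ _ (by rw [htriv, ht1])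
    rw [hcx, this, hcf1, dualCoboundary_apply]; simp
  · push Not at htriv
    obtain ⟨q₀, hq₀⟩ := htriv
    have hp0 : p • c q₀ f = 0 := by
      rw [← hcfpow, ← hcf1]
      congr 1
      exact congrArg c (htinj _ _ (by rw [htpow, ht1]; simp))
    let χ : ZMod p →+ A := ZMod.lift p ⟨zmultiplesHom A (c q₀ f), by simpa using hp0⟩
    have hχ : ∀ n : ℕ, χ n = n • c q₀ f := fun n => by
      have := ZMod.lift_coe p ⟨zmultiplesHom A (c q₀ f), by simpa using hp0⟩ (n : ℤ)
      simpa using this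
    -- Applying `k⁻¹` lowers the `e`-coordinate `symp x f` by `t k * symp e x`, so this form has the
    -- coboundary `χ (t k * symp e x / t q₀)`, which is `c k x`.
    refine ⟨AddMonoidHom.mk' (fun x => -χ (symp x f / t q₀)) fun x y => by
      rw [symp_add_left, add_div, map_add, neg_add], fun k => ?_⟩
    refine DFunLike.ext _ _ fun x => ?_
    rw [dualCoboundary_apply]
    change _ = -χ _ - -χ _
    have h1 : symp (toLin' (ι k⁻¹) x) f = symp x f - t k * symp e x := by
      conv_lhs => rw [eq_symp_smul_add hef x]
      rw [map_add, map_smul, map_smul, he, symp_add_left, symp_smul_left, symp_smul_left, hef]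
      change _ + _ * t k⁻¹ = _
      rw [htinv]; ring
    set n : ℕ := (t k / t q₀).val with hn
    have hk : k = q₀ ^ n := htinj _ _ (by
      rw [htpow, hn, ZMod.natCast_zmod_val, div_mul_cancel₀ _ hq₀])
    rw [h1, hcx, hk, hcfpow, ← hk, smul_smul, ← hχ, sub_neg_eq_add, neg_add_eq_sub, ← map_sub]
    congr 1
    rw [Nat.cast_mul, ZMod.natCast_zmod_val, hn, ZMod.natCast_zmod_val]
    field_simp
    ring

/-- Restriction of `H¹(K, Hom(𝔽_p², A))` to a Sylow `p`-subgroup is injective. -/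
theorem exists_eq_dualCoboundary_of_sylow [Finite K] (P : Sylow p K)
    (c : K → (Fin 2 → ZMod p) →+ A) (hc : IsDualCocycle ι c) (hP : ∀ q ∈ P, c q = 0) :
    ∃ ψ, ∀ k, c k = dualCoboundary ι ψ k := by
  have := Fintype.ofFinite (K ⧸ (P : Subgroup K))
  -- Vanishing on `P` lets `c` descend to `K / P`. Averaging there is possible because the index is
  -- prime to `p` and `Hom(𝔽_p², A)` is killed by `p`.
  have hcP : ∀ k, ∀ q ∈ P, c (k * q) = c k := fun k q hq => by
    refine DFunLike.ext _ _ fun x => ?_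
    rw [hc, hP q hq]; simp
  have hout : ∀ k : K, c (k : K ⧸ (P : Subgroup K)).out = c k := fun k => by
    obtain ⟨q, hq⟩ := QuotientGroup.mk_out_eq_mul (P : Subgroup K) k
    rw [hq, hcP k q q.2]
  set S : (Fin 2 → ZMod p) →+ A := ∑ y : K ⧸ (P : Subgroup K), c y.out with hS
  have key : ∀ k x, S x = Fintype.card (K ⧸ (P : Subgroup K)) • c k x + S (toLin' (ι k⁻¹) x) :=
    fun k x => by
      have h1 : S x = ∑ y : K ⧸ (P : Subgroup K), c (k • y).out x := by
        rw [hS, AddMonoidHom.finsetSum_apply]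
        exact (Fintype.sum_equiv (MulAction.toPerm k) _ _ fun _ => rfl).symm
      have h2 : ∀ y : K ⧸ (P : Subgroup K), c (k • y).out x =
          c k x + c y.out (toLin' (ι k⁻¹) x) := fun y => by
        obtain ⟨z, rfl⟩ := QuotientGroup.mk_surjective y
        have : k • (z : K ⧸ (P : Subgroup K)) = ((k * z : K) : K ⧸ (P : Subgroup K)) := rfl
        rw [this, hout, hout, hc]
      rw [h1]
      simp only [h2, Finset.sum_add_distrib, Finset.sum_const, Finset.card_univ, hS,
        AddMonoidHom.finsetSum_apply]
  set n := Fintype.card (K ⧸ (P : Subgroup K)) with hn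
  have hnp : (n : ZMod p) ≠ 0 := by
    rw [Ne, ZMod.natCast_eq_zero_iff]
    have := P.not_dvd_index
    rwa [Subgroup.index, Nat.card_eq_fintype_card] at this
  set m : ℕ := ((n : ZMod p)⁻¹).val with hm
  have hmn : ∀ (F : (Fin 2 → ZMod p) →+ A) x, (m * n) • F x = F x := fun F x => by
    rw [← map_nsmul]
    congr 1
    ext i
    rw [Pi.smul_apply, nsmul_eq_mul, Nat.cast_mul, hm, ZMod.natCast_zmod_val,
      inv_mul_cancel₀ hnp, one_mul]
  refine ⟨-(m • S), fun k => ?_⟩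
  refine DFunLike.ext _ _ fun x => ?_
  rw [dualCoboundary_apply, ← hmn (c k) x, mul_smul, eq_sub_of_add_eq (key k x).symm]
  simp only [AddMonoidHom.neg_apply, AddMonoidHom.nsmul_apply, smul_sub]
  abel

/-- A locally trivial class in `H¹(K, Hom(𝔽_p², A))` is trivial for a subgroup `K` of
`SL₂(𝔽_p)`. -/
theorem exists_eq_dualCoboundary [Finite K] (hι : Function.Injective ι)
    (c : K → (Fin 2 → ZMod p) →+ A) (hc : IsDualCocycle ι c)
    (hfix : ∀ k x, toLin' (ι k) x = x → c k x = 0) :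
    ∃ ψ, ∀ k, c k = dualCoboundary ι ψ k := by
  obtain ⟨P⟩ : Nonempty (Sylow p K) := inferInstance
  obtain ⟨ψ, hψ⟩ := exists_eq_dualCoboundary_of_isPGroup
    (ι.comp (P : Subgroup K).subtype) P.2 (hι.comp Subtype.val_injective)
    (fun q => c q) (fun k k' x => hc k k' x) (fun k x => hfix k x)
  obtain ⟨ψ', hψ'⟩ := exists_eq_dualCoboundary_of_sylow ι P (c - dualCoboundary ι ψ)
    (hc.sub (isDualCocycle_dualCoboundary ι ψ)) (fun q hq => sub_eq_zero.2 (hψ ⟨q, hq⟩))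
  refine ⟨ψ' + ψ, fun k => ?_⟩
  rw [eq_add_of_sub_eq (hψ' k)]
  refine DFunLike.ext _ _ fun x => ?_
  simp only [AddMonoidHom.add_apply, dualCoboundary_apply]
  abel

end FirstCohomology

end SL2


/-! ### The pairing invariant and the Heisenberg cocycle on `𝔽_p² ⋊ K` -/

section Affine

open Matrix.SpecialLinearGroup (toLin')

variable {p : ℕ} [Fact p.Prime] {K A : Type} [Group K] [AddCommGroup A]
  {φ : K →* MulAut (Multiplicative (Fin 2 → ZMod p))}

/-- The group `K` acts on `𝔽_p²` through the homomorphism `ι` to `SL₂(𝔽_p)`. -/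
def ActsThrough (φ : K →* MulAut (Multiplicative (Fin 2 → ZMod p))) (ι : K →* SL(2, ZMod p)) :
    Prop :=
  ∀ k v, φ k v = Multiplicative.ofAdd (toLin' (ι k) v.toAdd)

variable {ι : K →* SL(2, ZMod p)}

theorem ActsThrough.rAct_eq (hφ : ActsThrough φ ι)
    (g : Multiplicative (Fin 2 → ZMod p) ⋊[φ] K) (x : Fin 2 → ZMod p) :
    rAct g x = toLin' (ι g.right⁻¹) (x + g.left.toAdd) := by
  rw [rAct, ← map_inv, hφ]; rfl

theorem IsCocycle.factorSet_mul {U : Multiplicative (Fin 2 → ZMod p) ⋊[φ] K → _ → A}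
    (hU : IsCocycle U) (v w x : Fin 2 → ZMod p) :
    U (SemidirectProduct.inl (Multiplicative.ofAdd (v + w))) x =
      U (SemidirectProduct.inl (Multiplicative.ofAdd v)) x +
        U (SemidirectProduct.inl (Multiplicative.ofAdd w)) (x + v) -
          U (SemidirectProduct.inl (Multiplicative.ofAdd w)) v := by
  rw [ofAdd_add, map_mul, hU.mul, rAct_inl, rAct_inl, toAdd_ofAdd, zero_add]

/-- The value on the standard basis of the commutator pairing of a cocycle. -/
def pairingValue (U : Multiplicative (Fin 2 → ZMod p) ⋊[φ] K → (Fin 2 → ZMod p) → A) : A :=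
  U (SemidirectProduct.inl (Multiplicative.ofAdd (Pi.single 0 1))) (Pi.single 1 1) -
    U (SemidirectProduct.inl (Multiplicative.ofAdd (Pi.single 1 1))) (Pi.single 0 1)

theorem IsCocycle.nsmul_pairingValue {U : Multiplicative (Fin 2 → ZMod p) ⋊[φ] K → _ → A}
    (hU : IsCocycle U) : p • pairingValue U = 0 := by
  have h : p • commutatorPairing
      (c := fun v => U (SemidirectProduct.inl (Multiplicative.ofAdd v))) hU.factorSet_mul
      (Pi.single 0 1) (Pi.single 1 1) = 0 := by
    rw [← map_nsmul]
    have : p • (Pi.single 1 1 : Fin 2 → ZMod p) = 0 := by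
      ext i; rw [Pi.smul_apply, nsmul_eq_mul, CharP.cast_eq_zero, zero_mul]; rfl
    rw [this, map_zero]
  exact h

theorem pairingValue_coboundary (ψ : (Fin 2 → ZMod p) → A) :
    pairingValue (coboundary φ ψ) = 0 := by
  simp only [pairingValue, coboundary, rAct_inl, toAdd_ofAdd, zero_add]
  rw [add_comm (Pi.single 1 1)]; abel

/-- A cocycle with trivial commutator pairing is cohomologous to one that vanishes on `𝔽_p²`. -/
theorem IsCocycle.exists_eq_coboundary_inl [DivisibleBy A ℤ]
    {U : Multiplicative (Fin 2 → ZMod p) ⋊[φ] K → _ → A} (hU : IsCocycle U)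
    (h : pairingValue U = 0) :
    ∃ ψ, ∀ v x, U (SemidirectProduct.inl v) x = coboundary φ ψ (SemidirectProduct.inl v) x := by
  have hs := pairing_eq_zero (commutatorPairing
    (c := fun v => U (SemidirectProduct.inl (Multiplicative.ofAdd v))) hU.factorSet_mul) (fun v => sub_self _) h
  obtain ⟨ψ, hψ0, hψ⟩ := exists_splitting (fun v => hU.zero_right _) hU.factorSet_mul
    (fun v w => sub_eq_zero.1 (hs v w))
  refine ⟨ψ, fun v x => ?_⟩
  rw [coboundary, rAct_inl, rAct_inl, zero_add, hψ0, add_zero]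
  exact hψ v.toAdd x

section Vanishing

variable {W : Multiplicative (Fin 2 → ZMod p) ⋊[φ] K → (Fin 2 → ZMod p) → A}

theorem IsCocycle.apply_eq_apply_inr (hW : IsCocycle W)
    (h0 : ∀ v x, W (SemidirectProduct.inl v) x = 0)
    (g : Multiplicative (Fin 2 → ZMod p) ⋊[φ] K) (x : Fin 2 → ZMod p) :
    W g x = W (SemidirectProduct.inr g.right) x := by
  conv_lhs => rw [← inr_mul_inl_rAct g, hW.mul, h0, h0, add_zero, sub_zero]

/-- Since `W` depends only on the `K`-component, its values at `k` and at `v * k` agree, and the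
cocycle identity for `v * k` becomes additivity. -/
theorem IsCocycle.inr_add (hW : IsCocycle W) (h0 : ∀ v x, W (SemidirectProduct.inl v) x = 0)
    (k : K) (x v : Fin 2 → ZMod p) :
    W (SemidirectProduct.inr k) (x + v) =
      W (SemidirectProduct.inr k) x + W (SemidirectProduct.inr k) v := by
  have h1 := hW.mul (SemidirectProduct.inl (Multiplicative.ofAdd v)) (SemidirectProduct.inr k) x
  rw [hW.apply_eq_apply_inr h0, h0, rAct_inl, rAct_inl, toAdd_ofAdd, zero_add, zero_add,
    SemidirectProduct.mul_right, SemidirectProduct.right_inl, SemidirectProduct.right_inr,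
    one_mul] at h1
  rw [h1, sub_add_cancel]

end Vanishing

/-- A cocycle with trivial commutator pairing that is a coboundary on cyclic subgroups is a
coboundary. -/
theorem ActsThrough.isCoboundaryOn_top [DivisibleBy A ℤ] [Finite K] (hφ : ActsThrough φ ι)
    (hι : Function.Injective ι)
    {U : Multiplicative (Fin 2 → ZMod p) ⋊[φ] K → _ → A} (hU : IsCocycle U)
    (h : pairingValue U = 0)
    (hloc : ∀ D : Subgroup (Multiplicative (Fin 2 → ZMod p) ⋊[φ] K), IsCyclic D →
      IsCoboundaryOn D U) : IsCoboundaryOn ⊤ U := by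
  obtain ⟨ψ, hψ⟩ := hU.exists_eq_coboundary_inl h
  set W := U - coboundary φ ψ with hWdef
  have hW : IsCocycle W := hU.sub (isCocycle_coboundary ψ)
  have h0 : ∀ v x, W (SemidirectProduct.inl v) x = 0 := fun v x => sub_eq_zero.2 (hψ v x)
  have hr : ∀ k x, rAct (SemidirectProduct.inr k : Multiplicative (Fin 2 → ZMod p) ⋊[φ] K) x =
      toLin' (ι k⁻¹) x := fun k x => by
    rw [hφ.rAct_eq]; simp
  obtain ⟨ψ', hψ'⟩ := exists_eq_dualCoboundary ι hι
    (fun k => AddMonoidHom.mk' (W (SemidirectProduct.inr k)) (hW.inr_add h0 k))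
    (fun k k' x => by
      change W (SemidirectProduct.inr (k * k')) x = W (SemidirectProduct.inr k) x +
        W (SemidirectProduct.inr k') (toLin' (ι k⁻¹) x)
      rw [map_mul, hW.mul, rAct_inr_zero, hW.zero_right, sub_zero, hr])
    (fun k x hx => by
      change U (SemidirectProduct.inr k) x - coboundary φ ψ (SemidirectProduct.inr k) x = 0
      obtain ⟨χ, hχ⟩ := hloc (Subgroup.zpowers (SemidirectProduct.inr k)) inferInstance
      have hx' : rAct (SemidirectProduct.inr k : Multiplicative (Fin 2 → ZMod p) ⋊[φ] K) x =
          x := by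
        rw [hr, map_inv, map_inv]
        exact (LinearEquiv.symm_apply_eq _).2 hx.symm
      -- Any coboundary at `k` vanishes at a point fixed by `k`, since `k` also fixes `0`.
      rw [hχ _ (Subgroup.mem_zpowers _)]
      simp only [coboundary, hx', rAct_inr_zero]
      abel)
  refine ⟨ψ' + ψ, fun g _ x => ?_⟩
  have h1 : W g x = ψ' (toLin' (ι g.right⁻¹) x) - ψ' x := by
    rw [hW.apply_eq_apply_inr h0]
    exact DFunLike.congr_fun (hψ' g.right) x
  rw [eq_add_of_sub_eq (show U g x - coboundary φ ψ g x = _ from h1)]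
  simp only [coboundary, hφ.rAct_eq, Pi.add_apply, map_add, map_zero, zero_add]
  abel

/-- The cocycle attached to the Heisenberg extension of `𝔽_p² ⋊ K`. -/
def heisenberg (φ : K →* MulAut (Multiplicative (Fin 2 → ZMod p))) (l : ZMod p →+ A)
    (g : Multiplicative (Fin 2 → ZMod p) ⋊[φ] K) (x : Fin 2 → ZMod p) : A :=
  l (symp g.left.toAdd x)

theorem pairingValue_heisenberg (l : ZMod p →+ A) :
    pairingValue (heisenberg φ l) = l 2 := by
  simp only [pairingValue, heisenberg, SemidirectProduct.left_inl, toAdd_ofAdd, ← map_sub, symp]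
  congr 1
  simp
  norm_num

theorem ActsThrough.isCocycle_heisenberg (hφ : ActsThrough φ ι) (l : ZMod p →+ A) :
    IsCocycle (heisenberg φ l) where
  zero_right g := by simp [heisenberg, symp]
  mul g h x := by
    have h1 : symp h.left.toAdd (toLin' (ι g.right⁻¹) x) =
        symp (toLin' (ι g.right) h.left.toAdd) x := by
      rw [← symp_toLin' (ι g.right)]
      congr 1
      rw [map_inv, map_inv]
      exact LinearEquiv.apply_symm_apply _ _
    simp only [heisenberg, SemidirectProduct.mul_left, hφ g.right, toAdd_mul, toAdd_ofAdd,
      hφ.rAct_eq, map_add, symp_add_left, symp_add_right, zero_add, h1]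
    abel

/-- Put `ψ = 0` on the slice `t = 0` and determine it elsewhere by summing `F` along the `(-t
x).val` steps that lead to the slice. Leaving the slice takes `p - 1` further steps to return, and
the vanishing sum over `p` steps is the consistency condition there. -/
theorem exists_forall_sub_eq {X : Type} (T : X → X) (t : X → ZMod p) (ht : ∀ x, t (T x) = t x + 1)
    (F : X → A) (hF : ∀ x, ∑ i ∈ Finset.range p, F (T^[i] x) = 0) :
    ∃ ψ : X → A, ∀ x, F x = ψ (T x) - ψ x := by
  refine ⟨fun x => -∑ i ∈ Finset.range (-t x).val, F (T^[i] x), fun x => ?_⟩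
  have hT : -t (T x) = -t x - 1 := by rw [ht]; ring
  have hstep : ∀ n, ∑ i ∈ Finset.range (n + 1), F (T^[i] x) =
      ∑ i ∈ Finset.range n, F (T^[i] (T x)) + F x := fun n => by
    rw [Finset.sum_range_succ']; rfl
  have hp1 : p - 1 + 1 = p := Nat.sub_add_cancel (Fact.out : p.Prime).one_le
  by_cases hx : (-t x).val = 0
  · have h1 : -t x = 0 := (ZMod.val_eq_zero _).1 hx
    have h2 : (-t (T x)).val = p - 1 := by
      rw [hT, h1, zero_sub, ← Nat.succ_inj, Nat.succ_eq_add_one, Nat.succ_eq_add_one, hp1]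
      obtain ⟨n, rfl⟩ : ∃ n, p = n + 1 := ⟨p - 1, hp1.symm⟩
      rw [ZMod.val_neg_one]
    have h3 := hF x
    rw [← hp1, hstep] at h3
    simp only [h2, hx, Finset.range_zero, Finset.sum_empty, neg_zero, sub_zero]
    exact (neg_eq_of_add_eq_zero_right h3).symm
  · obtain ⟨n, hn⟩ : ∃ n, (-t x).val = n + 1 := Nat.exists_eq_succ_of_ne_zero hx
    have h2 : (-t (T x)).val = n := by
      have h3 : -t (T x) = (n : ZMod p) := by
        rw [hT, ← ZMod.natCast_zmod_val (-t x), hn]; push_cast; ring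
      rw [h3, ZMod.val_natCast, Nat.mod_eq_of_lt]
      have := ZMod.val_lt (-t x)
      omega
    simp only [h2, hn, hstep]
    abel

/-- A matrix `N` in `SL₂` for which `1 - N` is not surjective is unipotent. -/
theorem toLin'_toLin'_of_forall_ne (N : SL(2, ZMod p)) (b : Fin 2 → ZMod p)
    (hb : ∀ y, y - toLin' N y ≠ b) (x : Fin 2 → ZMod p) :
    toLin' N (toLin' N x) = toLin' N x + (toLin' N x - x) := by
  -- With `det N = 1` this gives trace `2`, and Cayley–Hamilton reads `N² = 2N - 1`.
  have hdet : (1 - N.1).det = 0 := by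
    by_contra h
    have hu : IsUnit (1 - N.1) := (Matrix.isUnit_iff_isUnit_det _).2 (isUnit_iff_ne_zero.2 h)
    obtain ⟨y, hy⟩ := Matrix.mulVec_surjective_iff_isUnit.2 hu b
    apply hb y
    rw [← hy, Matrix.sub_mulVec, Matrix.one_mulVec]
    rfl
  have hN := N.2
  rw [Matrix.det_fin_two] at hdet hN
  simp only [Matrix.sub_apply, Matrix.one_apply_eq, Matrix.one_apply_ne (zero_ne_one),
    Matrix.one_apply_ne (one_ne_zero), zero_sub] at hdet
  simp only [Matrix.SpecialLinearGroup.toLin'_apply, Matrix.toLin'_apply]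
  ext i
  fin_cases i
  · simp only [Matrix.mulVec, dotProduct, Fin.sum_univ_two, Pi.add_apply, Pi.sub_apply,
      Fin.zero_eta]
    linear_combination (N.1 0 0 * x 0 + N.1 0 1 * x 1) * (hN - hdet) - x 0 * hN
  · simp only [Matrix.mulVec, dotProduct, Fin.sum_univ_two, Pi.add_apply, Pi.sub_apply,
      Fin.mk_one]
    linear_combination (N.1 1 0 * x 0 + N.1 1 1 * x 1) * (hN - hdet) - x 1 * hN

/-- The Heisenberg cocycle is a coboundary at each element. -/
theorem ActsThrough.exists_heisenberg_eq [DivisibleBy A ℤ] (hp : 2 < p) (hφ : ActsThrough φ ι)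
    (l : ZMod p →+ A) (g : Multiplicative (Fin 2 → ZMod p) ⋊[φ] K) :
    ∃ ψ, ∀ x, heisenberg φ l g x = coboundary φ ψ g x := by
  set v := g.left.toAdd with hv
  set N := ι g.right⁻¹ with hN
  have hT : ∀ x, rAct g x = toLin' N x + toLin' N v := fun x => by rw [hφ.rAct_eq, map_add]
  by_cases hfix : ∃ y, y - toLin' N y = toLin' N v
  · obtain ⟨y, hy⟩ := hfix
    -- Here `y` is a fixed point of the affine map `rAct g`.
    refine ⟨fun x => l (symp y x), fun x => ?_⟩
    have h1 : symp v x = symp y (toLin' N x) - symp y x := by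
      rw [← symp_toLin' N v x, ← hy, sub_eq_add_neg, ← neg_one_smul (ZMod p) (toLin' N y),
        symp_add_left, symp_smul_left, symp_toLin']
      ring
    have h2 : symp y 0 = 0 := by simp [symp]
    simp only [heisenberg, coboundary, hT, symp_add_right, map_add, ← hv, h1, map_sub, h2,
      map_zero, zero_add]
    abel
  · push Not at hfix
    have huni := toLin'_toLin'_of_forall_ne N _ hfix
    have hmem : toLin' N v ∉ LinearMap.range (LinearMap.id - (toLin' N).toLinearMap) := by
      rintro ⟨y, hy⟩
      exact hfix y hy
    -- An `N`-invariant linear form with `ℓ (N v) ≠ 0`; after scaling it grows by `1` at each step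
    -- of `rAct g`.
    obtain ⟨ℓ, hℓv, hℓ⟩ := Submodule.exists_le_ker_of_notMem hmem
    have hℓN : ∀ y, ℓ (toLin' N y) = ℓ y := fun y => by
      have : ℓ (y - toLin' N y) = 0 := hℓ ⟨y, rfl⟩
      rw [map_sub] at this
      exact (sub_eq_zero.1 this).symm
    -- Unipotence gives `N ^ i = 1 + i (N - 1)`.
    have hiter : ∀ (i : ℕ) x, (rAct g)^[i] x =
        (rAct g)^[i] 0 + (x + (i : ZMod p) • (toLin' N x - x)) := fun i x => by
      induction i with
      | zero => simp
      | succ i ih =>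
        rw [Function.iterate_succ_apply', Function.iterate_succ_apply', ih, hT, hT, map_add,
          map_add, map_smul, map_sub, huni, add_sub_cancel_left]
        push_cast
        module
    have hsum : ∀ x, ∑ i ∈ Finset.range p, symp v ((rAct g)^[i] x) =
        ∑ i ∈ Finset.range p, symp v ((rAct g)^[i] 0) := fun x => by
      have h2 : (2 : ZMod p) ≠ 0 := by
        intro h
        have := (ZMod.natCast_eq_zero_iff 2 p).1 (by exact_mod_cast h)
        exact absurd (Nat.le_of_dvd two_pos this) (by omega)
      have h3 : ∑ i ∈ Finset.range p, (i : ZMod p) = 0 := by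
        have h4 := congrArg (Nat.cast : ℕ → ZMod p) (Finset.sum_range_id_mul_two p)
        push_cast at h4
        rw [CharP.cast_eq_zero, zero_mul] at h4
        exact (mul_eq_zero.1 h4).resolve_right h2
      simp only [hiter _ x, symp_add_right, symp_smul_right, Finset.sum_add_distrib,
        ← Finset.sum_mul, h3, Finset.sum_const, Finset.card_range, nsmul_eq_mul,
        CharP.cast_eq_zero, zero_mul, add_zero]
    set C := ∑ i ∈ Finset.range p, symp v ((rAct g)^[i] 0) with hC
    have hp0 : (p : ℤ) ≠ 0 := by exact_mod_cast (Fact.out : p.Prime).ne_zero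
    -- Subtracting a `p`-th part of the common sum `l C` makes every sum over `p` steps vanish. This
    -- constant is harmless because cocycles are taken modulo constants.
    obtain ⟨ψ, hψ⟩ := exists_forall_sub_eq (rAct g) (fun x => ℓ x / ℓ (toLin' N v))
      (fun x => by rw [hT, map_add, hℓN, add_div, div_self hℓv])
      (fun x => l (symp v x) - DivisibleBy.div (l C) (p : ℤ))
      (fun x => by
        rw [Finset.sum_sub_distrib, ← map_sum, hsum, Finset.sum_const, Finset.card_range,
          ← natCast_zsmul, DivisibleBy.div_cancel _ hp0, sub_self])
    refine ⟨ψ, fun x => ?_⟩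
    have h0 := hψ 0
    have hx := hψ x
    have h2 : symp v 0 = 0 := by simp [symp]
    simp only [h2, map_zero, zero_sub] at h0
    simp only [heisenberg, coboundary, ← hv]
    rw [eq_add_of_sub_eq hx, ← neg_neg (DivisibleBy.div (l C) (p : ℤ)), h0]
    abel

theorem ActsThrough.isCoboundaryOn_heisenberg [DivisibleBy A ℤ] (hp : 2 < p)
    (hφ : ActsThrough φ ι) (l : ZMod p →+ A)
    (D : Subgroup (Multiplicative (Fin 2 → ZMod p) ⋊[φ] K)) (hD : IsCyclic D) :
    IsCoboundaryOn D (heisenberg φ l) := by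
  obtain ⟨g, rfl⟩ := D.isCyclic_iff_exists_zpowers_eq_top.1 hD
  obtain ⟨ψ, hψ⟩ := hφ.exists_heisenberg_eq hp l g
  exact (hφ.isCocycle_heisenberg l).isCoboundaryOn_zpowers g ψ hψ

end Affine

theorem mem_range_toAddCircle {p : ℕ} [NeZero p] (a : UnitAddCircle) (ha : p • a = 0) :
    a ∈ (ZMod.toAddCircle : ZMod p →+ UnitAddCircle).range := by
  obtain ⟨r, rfl⟩ := QuotientAddGroup.mk_surjective a
  have h1 : ((p • r : ℝ) : UnitAddCircle) = 0 := ha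
  obtain ⟨n, hn⟩ := (AddCircle.coe_eq_zero_iff (1 : ℝ)).1 h1
  refine ⟨(n : ZMod p), ?_⟩
  rw [ZMod.toAddCircle_intCast]
  have hp : (p : ℝ) ≠ 0 := by exact_mod_cast NeZero.ne p
  rw [zsmul_eq_mul, mul_one, nsmul_eq_mul] at hn
  rw [hn, mul_div_cancel_left₀ _ hp]

/-- Both groups are the quotient of `Z` by one kernel. It is applied with `Z` the locally trivial
`2`-cocycles, `θ` the pairing value and `j` the inclusion of `ℤ/p` in the circle. -/
theorem nonempty_addEquiv_of_ker_eq {Z S A B : Type} [AddCommGroup Z] [AddCommGroup S]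
    [AddCommGroup A] [AddCommGroup B] (q : Z →+ S) (hq : Function.Surjective q) (θ : Z →+ A)
    (j : B →+ A) (hj : Function.Injective j) (hker : q.ker = θ.ker) (hrange : θ.range = j.range) :
    Nonempty (S ≃+ B) :=
  ⟨(QuotientAddGroup.quotientKerEquivOfSurjective q hq).symm.trans
    ((QuotientAddGroup.quotientAddEquivOfEq hker).trans
      ((QuotientAddGroup.quotientKerEquivRange θ).trans
        ((AddEquiv.addSubgroupCongr hrange).trans (AddMonoidHom.ofInjective hj).symm)))⟩

/-! ### Computation of `Ш²_ω` -/

section Main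

open Matrix.SpecialLinearGroup (toLin')

variable {p : ℕ} [Fact p.Prime] {K : Type} [Group K]
  {φ : K →* MulAut (Multiplicative (Fin 2 → ZMod p))} {ι : K →* SL(2, ZMod p)}

/-- `Ш²_ω(𝔽_p² ⋊ K, J) ≅ ℤ/p` for a group `K` acting faithfully on `𝔽_p²` through
`SL₂(𝔽_p)`. -/
theorem ActsThrough.nonempty_shaOmega_addEquiv (hp : 2 < p) (hφ : ActsThrough φ ι)
    (hι : Function.Injective ι) :
    Nonempty (shaOmega (chevalleyModule
      (SemidirectProduct.inr : K →* Multiplicative (Fin 2 → ZMod p) ⋊[φ] K).range) ≃+ ZMod p) := by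
  have : Finite K := Finite.of_injective ι hι
  have : Finite (Multiplicative (Fin 2 → ZMod p) ⋊[φ] K) :=
    Finite.of_equiv _ SemidirectProduct.equivProd.symm
  have := Fintype.ofFinite (Multiplicative (Fin 2 → ZMod p) ⋊[φ] K)
  set H := (SemidirectProduct.inr : K →* Multiplicative (Fin 2 → ZMod p) ⋊[φ] K).range with hH
  set M := chevalleyModule H with hM
  let Z : Submodule ℤ (groupCohomology.cocycles₂ M) :=
    (shaOmega M).comap (groupCohomology.H2π M).hom
  let q : Z →+ shaOmega M :=
    ((groupCohomology.H2π M).hom.restrict (p := Z) (q := shaOmega M) fun _ hx => hx).toAddMonoidHom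
  have hq : Function.Surjective q := by
    rintro ⟨y, hy⟩
    induction y using groupCohomology.H2_induction_on with
    | h f => exact ⟨⟨f, hy⟩, rfl⟩
  let R (f : groupCohomology.cocycles₂ M) (g : Multiplicative (Fin 2 → ZMod p) ⋊[φ] K)
    (y : Fin 2 → ZMod p) : UnitAddCircle :=
      circleCochain H f g (SemidirectProduct.inl (Multiplicative.ofAdd y))
  have hR : ∀ f, IsCocycle (R f) := fun f => (isCrossed_circleCochain H f).isCocycle
  let θ : Z →+ UnitAddCircle := AddMonoidHom.mk' (fun z => pairingValue (R z.1)) fun z z' => by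
    simp only [pairingValue, R, Submodule.coe_add, map_add, Pi.add_apply]; abel
  have hmem : ∀ f, (f ∈ Z ↔ ∀ D : Subgroup (Multiplicative (Fin 2 → ZMod p) ⋊[φ] K), IsCyclic D →
      IsCoboundaryOn D (R f)) := fun f => by
    refine (H2π_mem_shaOmega_iff H f).trans ?_
    exact forall₂_congr fun D _ => isTrivialOn_iff D (isCrossed_circleCochain H f)
  have hzero : ∀ f, groupCohomology.H2π M f = 0 ↔ IsCoboundaryOn ⊤ (R f) := fun f =>
    (H2π_eq_zero_iff_isTrivialOn H f).trans (isTrivialOn_iff ⊤ (isCrossed_circleCochain H f))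
  have hval : ∀ f, IsCoboundaryOn ⊤ (R f) → pairingValue (R f) = 0 := fun f ⟨ψ, hψ⟩ => by
    have : R f = coboundary φ ψ := funext₂ fun g x => hψ g trivial x
    rw [this, pairingValue_coboundary]
  refine nonempty_addEquiv_of_ker_eq q hq θ ZMod.toAddCircle (ZMod.toAddCircle_injective p) ?_ ?_
  · ext z
    have h1 : q z = 0 ↔ IsCoboundaryOn ⊤ (R z.1) := by
      rw [← hzero, ← Subtype.coe_inj]; rfl
    rw [AddMonoidHom.mem_ker, AddMonoidHom.mem_ker, h1]
    exact ⟨hval z.1, fun h => hφ.isCoboundaryOn_top hι (hR z.1) h ((hmem z.1).1 z.2)⟩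
  · refine le_antisymm ?_ ?_
    · rintro _ ⟨z, rfl⟩
      exact mem_range_toAddCircle _ (hR z.1).nsmul_pairingValue
    · rintro _ ⟨a, rfl⟩
      have h2 : (2 : ZMod p) ≠ 0 := by
        intro h
        have := (ZMod.natCast_eq_zero_iff 2 p).1 (by exact_mod_cast h)
        exact absurd (Nat.le_of_dvd two_pos this) (by omega)
      -- Division by `2` compensates for antisymmetrization, which doubles the symplectic form.
      let l : ZMod p →+ UnitAddCircle :=
        (ZMod.toAddCircle : ZMod p →+ UnitAddCircle).comp (AddMonoidHom.mulLeft (a / 2))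
      have hl2 : l 2 = ZMod.toAddCircle a := by
        change ZMod.toAddCircle (a / 2 * 2) = _
        rw [div_mul_cancel₀ _ h2]
      have hl := hφ.isCocycle_heisenberg l
      obtain ⟨f, hf⟩ := exists_circleCochain_eq H _ hl.isCrossed
      have hcross : IsCrossed H (circleCochain H f - fun g x => heisenberg φ l g (rAct x 0)) := by
        have h1 := isCrossed_circleCochain H f
        have h2 := hl.isCrossed
        refine ⟨fun g h hh x => ?_, fun g => ?_, fun g h x => ?_⟩
        · rw [Pi.sub_apply, Pi.sub_apply, Pi.sub_apply, h1.mul_left g h hh, h2.mul_left g h hh]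
        · rw [Pi.sub_apply, Pi.sub_apply, h1.one_right, h2.one_right, sub_zero]
        · simp only [Pi.sub_apply, h1.mul g h, h2.mul g h]; abel
      obtain ⟨ψ, hψ⟩ := (isTrivialOn_iff ⊤ hcross).1 hf
      have hRf : ∀ g x, R f g x = heisenberg φ l g x + coboundary φ ψ g x := fun g x => by
        rw [← hψ g trivial x]
        simp only [Pi.sub_apply, rAct_inl, zero_add, toAdd_ofAdd, R]
        abel
      have hfZ : f ∈ Z := (hmem f).2 fun D hD => by
        obtain ⟨χ, hχ⟩ := hφ.isCoboundaryOn_heisenberg hp l D hD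
        refine ⟨χ + ψ, fun g hg x => ?_⟩
        rw [hRf, hχ g hg]
        simp only [coboundary, Pi.add_apply]
        abel
      refine ⟨⟨f, hfZ⟩, ?_⟩
      change pairingValue (R f) = _
      have h3 : pairingValue (R f) = pairingValue (heisenberg φ l) +
          pairingValue (coboundary φ ψ) := by
        simp only [pairingValue, hRf]; abel
      rw [h3, pairingValue_coboundary, add_zero, pairingValue_heisenberg, hl2]

end Main

end ChevalleySha
end

/-- `Ш²_ω(G, J_{G/H}) ≅ ℤ/p` for `G = (C_p)² ⋊ G'` and `H = {1} ⋊ G'`, where `p` is an odd prime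
and `G'` is any subgroup of `SL₂(𝔽_p)`; and likewise for the full group `SL₂(𝔽_p)`. -/
theorem mainTheorem5 (p : ℕ) [Fact p.Prime] (hp : 2 < p) :
    (∀ G' : Subgroup (Matrix.SpecialLinearGroup (Fin 2) (ZMod p)),
      Nonempty (ChevalleySha.shaOmega
        (ChevalleySha.chevalleyModule (ChevalleySha.pointStabilizer p G')) ≃+ ZMod p)) ∧
    Nonempty (ChevalleySha.shaOmega
      (ChevalleySha.chevalleyModule
        (SemidirectProduct.inr : Matrix.SpecialLinearGroup (Fin 2) (ZMod p) →*
          Multiplicative (Fin 2 → ZMod p) ⋊[ChevalleySha.stdAction p]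
            Matrix.SpecialLinearGroup (Fin 2) (ZMod p)).range) ≃+ ZMod p) :=
  ⟨fun G' => ChevalleySha.ActsThrough.nonempty_shaOmega_addEquiv (ι := G'.subtype) hp
    (fun _ _ => rfl) Subtype.val_injective,
  ChevalleySha.ActsThrough.nonempty_shaOmega_addEquiv (ι := MonoidHom.id _) hp
    (fun _ _ => rfl) Function.injective_id⟩
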